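/- \textbf{Conventions.} Let $L'$ be a first-order language. For a tuple $\bar a$ (or a family indexed by a set) in an $L'$-structure, $\mathrm{qftp}(\bar a)$ is the set of quantifier-free $L'$-formulas true of $\bar a$. If $A$ is a finite set of elements of an $L'$-structure $P$ and $C$ is a set of elements of an $L'$-structure $Q$, a \emph{copy of $A$ in $C$} is a map $f:A\to C$ such that $\mathrm{qftp}_Q((f(a))_{a\in A})=\mathrm{qftp}_P((a)_{a\in A})$. For finite $A,B\subseteq P$ and $C\subseteq Q$ write $C\to(B)^A_2$ if for every colouring of the copies of $A$ in $C$ with two colours there is a copy $g$ of $B$ in $C$ such that all copies of $A$ whose values lie in $g(B)$ have the same colour. The age of an $L'$-structure $N$ is the class of finitely generated $L'$-structures embeddable in $N$. $N$ has the \emph{finitary Embedding Ramsey Property} if for every $P$ in its age and all finite $A,B\subseteq P$ there are $Q$ in the age of $N$ and a finite $C\subseteq Q$ with $C\to(B)^A_2$. Let $T$ be a complete theory with infinite models in a first-order language $L$, and let $\mathbb M\models T$ be a monster model, i.e. $\mathbb M$ is $\kappa$-saturated and $\kappa$-homogeneous for some cardinal $\kappa>\aleph_0,|L|,|N|$. A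 sequence $(\bar a_i)_{i\in N}$ of tuples of the same length from $\mathbb M$ is \emph{$N$-indiscernible} if, for all $n$ and all $i_1,\dots,i_n,j_1,\dots,j_n\in N$, $\mathrm{qftp}_N(i_1,\dots,i_n)=\mathrm{qftp}_N(j_1,\dots,j_n)$ implies $\mathrm{tp}_{\mathbb M}(\bar a_{i_1},\dots,\bar a_{i_n})=\mathrm{tp}_{\mathbb M}(\bar a_{j_1},\dots,\bar a_{j_n})$. A sequence $(\bar b_i)_{i\in N}$ is \emph{based on} $(\bar a_i)_{i\in N}$ if for every $n$, every finite set $\Delta$ of $L$-formulas and all $i_1,\dots,i_n\in N$ there are $j_1,\dots,j_n\in N$ with $\mathrm{qftp}_N(i_1,\dots,i_n)=\mathrm{qftp}_N(j_1,\dots,j_n)$ and $\mathrm{tp}^\Delta_{\mathbb M}(\bar b_{i_1},\dots,\bar b_{i_n})=\mathrm{tp}^\Delta_{\mathbb M}(\bar a_{j_1},\dots,\bar a_{j_n})$, where $\mathrm{tp}^\Delta$ is the restriction of the type to formulas in $\Delta$ and negations of formulas in $\Delta$ (that is, to those $\varphi$ with $\varphi\in\Delta$ or $\lnot\varphi\in\Delta$).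 $N$-indexed indiscernibles have the \emph{modelling property} if for all $L$, $T$ and $\mathbb M$ as above, every $N$-indexed sequence of tuples of the same finite length from $\mathbb M$ admits an $N$-indiscernible sequence in $\mathbb M$ based on it. \textbf{Theorem.} Let $L'$ be a first-order language and $N$ an arbitrary $L'$-structure. The following are equivalent: \begin{enumerate} \item $N$ has the finitary Embedding Ramsey Property. \item $N$-indexed indiscernibles have the modelling property. \item $N$-indexed indiscernibles have the modelling property for sequences of tuples of arbitrary small length, i.e. the property in (2) with tuples of any length of cardinality $<\kappa$ in place of finite length. \end{enumerate} -/

import Mathlib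

universe u v u₁ v₁ w x t

namespace GenInd

open FirstOrder FirstOrder.Language

open scoped FirstOrder Cardinal

/-! ### Types of tuples -/

section Types

variable (L : FirstOrder.Language.{u, v}) {M : Type w} [L.Structure M] {ι : Type t}

/-- The complete (parameter-free) type of the tuple `a`, in variables indexed by `ι`. -/
def tp (a : ι → M) : Set (L.Formula ι) :=
  {φ | φ.Realize a}

/-- The quantifier-free type of the tuple `a`. -/
def qftp (a : ι → M) : Set (L.Formula ι) :=
  {φ | BoundedFormula.IsQF φ ∧ φ.Realize a}

variable {L}

/-- The restriction of the type of `a` to the formulas in `Δ` and their negations. -/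
def tpOn (Δ : Set (L.Formula ι)) (a : ι → M) : Set (L.Formula ι) :=
  {φ | φ ∈ tp L a ∧ (φ ∈ Δ ∨ φ.not ∈ Δ)}

end Types

/-! ### The finitary embedding Ramsey property -/

section Ramsey

variable (L : FirstOrder.Language.{u, v}) {M : Type w} [L.Structure M] {K : Type x} [L.Structure K]

/-- The copies of the finite set `A` in the set `C`: maps `f : A → C` such that the tuple
`(f a)_{a ∈ A}` has the same quantifier-free type as the tuple `(a)_{a ∈ A}`. -/
def copies (A : Finset M) (C : Set K) : Set (A → K) :=
  {f | (∀ a, f a ∈ C) ∧ qftp L f = qftp L (fun a : A => (a : M))}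

/-- The partition arrow `C → (B)^A_r` for finite sets `A`, `B` of elements of `M` and a
set `C` of elements of `K`: for every colouring with `r` colours of the copies of `A` in `C`
there is a copy `g` of `B` in `C` such that all copies of `A` inside (the range of) `g`
receive the same colour. -/
def Arrows (C : Set K) (B A : Finset M) (r : ℕ) : Prop :=
  ∀ χ : copies L A C → Fin r, ∃ g ∈ copies L B C,
    ∀ f₁ f₂ : copies L A C, (∀ a, f₁.1 a ∈ Set.range g) → (∀ a, f₂.1 a ∈ Set.range g) →
      χ f₁ = χ f₂

/-- The finitary embedding Ramsey property of a class of structures. -/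
def ClassHasFERP (𝒞 : Set (CategoryTheory.Bundled.{w} L.Structure)) : Prop :=
  ∀ P ∈ 𝒞, ∀ A B : Finset P, ∃ Q ∈ 𝒞, ∃ C : Finset Q, Arrows L (C : Set Q) B A 2

/-- The finitary embedding Ramsey property of a structure `N`, i.e. of its age. -/
def HasFERP (N : Type w) [L.Structure N] : Prop :=
  ClassHasFERP L (L.age N)

end Ramsey

/-! ### Saturated and homogeneous models -/

section Monster

variable (L : FirstOrder.Language.{u, v}) (κ : Cardinal.{w}) (M : Type w) [L.Structure M]

/-- `M` is `κ`-saturated: every set of formulas in one free variable with parameters from a set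
of size `< κ` which is finitely satisfiable in `M` is satisfied in `M`. -/
def IsSaturated : Prop :=
  ∀ A : Set M, #A < κ → ∀ p : Set (L.Formula (A ⊕ Unit)),
    (∀ p₀ : Finset (L.Formula (A ⊕ Unit)), (p₀ : Set (L.Formula (A ⊕ Unit))) ⊆ p →
      ∃ c : M, ∀ φ ∈ p₀, φ.Realize (Sum.elim (fun a : A => (a : M)) (fun _ => c))) →
    ∃ c : M, ∀ φ ∈ p, φ.Realize (Sum.elim (fun a : A => (a : M)) (fun _ => c))

/-- `M` is `κ`-homogeneous: every partial elementary map of `M` into itself whose domain has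
size `< κ` can be extended to any further element of `M`. -/
def IsHomogeneous : Prop :=
  ∀ A : Set M, #A < κ → ∀ f : A → M, tp L f = tp L (fun a : A => (a : M)) →
    ∀ c : M, ∃ d : M,
      tp L (Sum.elim f (fun _ : Unit => d)) =
        tp L (Sum.elim (fun a : A => (a : M)) (fun _ : Unit => c))

end Monster

/-! ### Generalised indiscernibles and the modelling property -/

section Indiscernibles

variable (L' : FirstOrder.Language.{u, v}) {N : Type w} [L'.Structure N]
variable (L : FirstOrder.Language.{u₁, v₁}) {M : Type x} [L.Structure M] {α : Type t}

/-- The concatenation of the tuples `a (i 0), …, a (i (n - 1))`, each of length `α`. -/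
def concat (a : N → α → M) {n : ℕ} (i : Fin n → N) : Fin n × α → M :=
  fun p => a (i p.1) p.2

/-- `(a i : i ∈ N)` is an `N`-indexed indiscernible sequence of tuples of length `α`. -/
def IsIndiscernible (a : N → α → M) : Prop :=
  ∀ (n : ℕ) (i j : Fin n → N), qftp L' i = qftp L' j →
    tp L (concat a i) = tp L (concat a j)

/-- The sequence `b` is (locally) based on the sequence `a`. -/
def IsBasedOn (b a : N → α → M) : Prop :=
  ∀ (n : ℕ) (Δ : Finset (L.Formula (Fin n × α))) (i : Fin n → N),
    ∃ j : Fin n → N, qftp L' i = qftp L' j ∧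
      tpOn (Δ : Set (L.Formula (Fin n × α))) (concat b i) =
        tpOn (Δ : Set (L.Formula (Fin n × α))) (concat a j)

end Indiscernibles

section Modelling

variable (L' : FirstOrder.Language.{u, v}) (N : Type w) [L'.Structure N]

/-- `M` is a monster model (with respect to the index set `N`) of degree of saturation `κ`:
`κ` exceeds `ℵ₀`, the size of the language and the size of `N`, and `M` is `κ`-saturated
and `κ`-homogeneous. -/
def IsMonster (L : FirstOrder.Language.{u₁, v₁}) (κ : Cardinal.{max u₁ v₁ w})
    (M : Type (max u₁ v₁ w)) [L.Structure M] : Prop :=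
  ℵ₀ < κ ∧ Cardinal.lift.{w} L.card < κ ∧ Cardinal.lift.{max u₁ v₁} #N < κ ∧
    IsSaturated L κ M ∧ IsHomogeneous L κ M

/-- Every `N`-indexed sequence of tuples of length `α` from `M` admits an `N`-indiscernible
sequence in `M` based on it. -/
def ModelsSequencesIn (L : FirstOrder.Language.{u₁, v₁}) (M : Type x) [L.Structure M] (α : Type t) : Prop :=
  ∀ a : N → α → M, ∃ b : N → α → M, IsIndiscernible L' L b ∧ IsBasedOn L' L b a

/-- `T` has an infinite model. -/
def HasInfiniteModel {L : FirstOrder.Language.{u₁, v₁}} (T : L.Theory) : Prop :=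
  ∃ M : Theory.ModelType.{u₁, v₁, max u₁ v₁} T, Infinite M

/-- `N`-indiscernible sequences (of finite tuples of the same length) have the modelling
property in `T`. -/
def HasMPIn {L : FirstOrder.Language.{u₁, v₁}} (T : L.Theory) : Prop :=
  ∀ (κ : Cardinal.{max u₁ v₁ w}) (M : Type (max u₁ v₁ w)) [L.Structure M] [M ⊨ T],
    IsMonster N L κ M → ∀ m : ℕ, ModelsSequencesIn L' N L M (Fin m)

/-- The same for tuples of arbitrary small (possibly infinite) length. -/
def HasMPInSmall {L : FirstOrder.Language.{u₁, v₁}} (T : L.Theory) : Prop :=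
  ∀ (κ : Cardinal.{max u₁ v₁ w}) (M : Type (max u₁ v₁ w)) [L.Structure M] [M ⊨ T],
    IsMonster N L κ M → ∀ α : Type (max u₁ v₁ w), #α < κ → ModelsSequencesIn L' N L M α

/-- `N`-indiscernible sequences of finite tuples have the modelling property: they have it in
every complete first-order theory with infinite models. -/
def HasMP : Prop :=
  ∀ (L : FirstOrder.Language.{u₁, v₁}) (T : L.Theory), T.IsComplete →
    HasInfiniteModel T → HasMPIn L' N T

/-- `N`-indiscernible sequences of tuples of arbitrary small length have the modelling property. -/
def HasMPSmall : Prop :=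
  ∀ (L : FirstOrder.Language.{u₁, v₁}) (T : L.Theory), T.IsComplete →
    HasInfiniteModel T → HasMPInSmall L' N T

end Modelling

end GenInd

namespace GenInd

open FirstOrder FirstOrder.Language

open scoped FirstOrder Cardinal

/-! ### Quantifier-free types and partition arrows for tuples -/

section Tuples

variable {L : FirstOrder.Language.{u, v}} {M K : Type*} [L.Structure M] [L.Structure K]
variable {ι ι' β β' : Type*}

/-! Both directions pass through a local form of the Ramsey property inside `N` (`hasFERP_iff`): for
every finite tuple `a` and finite `F ⊆ N`, some finite `C ⊆ N` arrows `F` for copies of `a`. By an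
ultrafilter argument it suffices that `N` itself arrows `F`.

Ramsey to modelling: iterating the arrow, finitely many colourings can be made homogeneous on a copy
of any finite `F` (`HasFERP.exists_isHomogeneousOn`). Colouring index tuples by the truth of
formulas along `a` shows that indiscernibility together with the Ehrenfeucht–Mostowski information
about `a` is finitely satisfiable by re-indexings of `a`. Saturation, extended to fewer than `κ`
variables (`IsSaturated.exists_realize`), then yields the sequence, with no restriction to finite
tuples.

Modelling to Ramsey: a colouring of `n`-tuples of `N` is encoded as an `n`-ary relation on the
generators of a saturated homogeneous structure, `GenericModel`. An indiscernible sequence based on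
the generators gives copies of `a` one colour; being based on them carries the relations on `F` back
to a homogeneous copy of `F` in `N`. The monster is built freely, so that it exists at a prescribed
successor cardinal without any cardinal arithmetic. -/

theorem qftp_comp {a : ι → M} {b : ι → K} (h : qftp L a = qftp L b) (σ : ι' → ι) :
    qftp L (a ∘ σ) = qftp L (b ∘ σ) := by
  ext φ
  refine and_congr_right fun hφ => ?_
  have h' := Set.ext_iff.1 h (Formula.relabel σ φ)
  have hq : BoundedFormula.IsQF (Formula.relabel σ φ) := BoundedFormula.IsQF.relabel hφ _
  simpa [qftp, hq] using h'

theorem qftp_embedding (e : M ↪[L] K) (a : ι → M) : qftp L (e ∘ a) = qftp L a := by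
  ext φ
  refine and_congr_right fun hφ => ?_
  have := BoundedFormula.IsQF.realize_embedding hφ e (v := a) (xs := default)
  rw [Formula.Realize, Formula.Realize, ← this]
  exact iff_of_eq (congrArg _ (Subsingleton.elim _ _))

theorem eq_of_qftp_eq {a : ι → M} {b : ι → K} (h : qftp L a = qftp L b) {i j : ι}
    (hij : a i = a j) : b i = b j := by
  have h' := Set.ext_iff.1 h ((Term.var i).equal (Term.var j))
  have hq : BoundedFormula.IsQF ((Term.var i : L.Term ι).equal (Term.var j)) :=
    (BoundedFormula.IsAtomic.equal _ _).isQF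
  simpa [qftp, hq, hij] using h'

theorem tp_comp {a b : ι → M} (h : tp L a = tp L b) (σ : ι' → ι) :
    tp L (a ∘ σ) = tp L (b ∘ σ) := by
  ext φ
  simpa [tp] using Set.ext_iff.1 h (Formula.relabel σ φ)

/-- The partition arrow for tuples: every two-colouring of the tuples in `K` admits a copy `g` in
`C` of the tuple `b` such that all subtuples of `g` that are copies of `a` have the same colour. -/
def TupleArrows (L : FirstOrder.Language.{u, v}) [L.Structure M] [L.Structure K] (C : Set K)
    (b : β → M) (a : ι → M) : Prop :=
  ∀ χ : (ι → K) → Prop, ∃ g : β → K, (∀ x, g x ∈ C) ∧ qftp L g = qftp L b ∧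
    ∀ σ τ : ι → β, qftp L (b ∘ σ) = qftp L a → qftp L (b ∘ τ) = qftp L a →
      (χ (g ∘ σ) ↔ χ (g ∘ τ))

theorem arrows_two_iff (C : Set K) (A B : Finset M) :
    Arrows L C B A 2 ↔ TupleArrows L C (fun b : B => (b : M)) (fun a : A => (a : M)) := by
  classical
  constructor
  · intro h χ
    obtain ⟨g, ⟨hgC, hg⟩, hmono⟩ := h fun f => if χ f.1 then 1 else 0
    refine ⟨g, hgC, hg, fun σ τ hσ hτ => ?_⟩
    have := hmono ⟨g ∘ σ, fun _ => hgC _, (qftp_comp hg σ).trans hσ⟩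
      ⟨g ∘ τ, fun _ => hgC _, (qftp_comp hg τ).trans hτ⟩ (fun _ => ⟨_, rfl⟩) fun _ => ⟨_, rfl⟩
    by_cases h₁ : χ (g ∘ σ) <;> by_cases h₂ : χ (g ∘ τ) <;> simp_all
  · intro h χ
    obtain ⟨g, hgC, hg, hmono⟩ := h fun f => ∃ hf : f ∈ copies L A C, χ ⟨f, hf⟩ = 1
    refine ⟨g, ⟨hgC, hg⟩, ?_⟩
    rintro ⟨f₁, h₁⟩ ⟨f₂, h₂⟩ hr₁ hr₂
    choose σ hσ using hr₁
    choose τ hτ using hr₂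
    obtain rfl : g ∘ σ = f₁ := funext hσ
    obtain rfl : g ∘ τ = f₂ := funext hτ
    have := hmono σ τ ((qftp_comp hg σ).symm.trans h₁.2) ((qftp_comp hg τ).symm.trans h₂.2)
    have h₃ : χ ⟨g ∘ σ, h₁⟩ = 1 ↔ χ ⟨g ∘ τ, h₂⟩ = 1 :=
      ⟨fun h => (this.1 ⟨h₁, h⟩).2, fun h => (this.2 ⟨h₂, h⟩).2⟩
    omega

/-- Quantifier-free types record equalities, so every copy of `a ∘ t` factors through `t`; a section
of the surjection `t` therefore turns it into a copy of `a`. This makes repetitions in tuples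
harmless when passing between sets and tuples. -/
theorem TupleArrows.comp {C : Set K} {b : β → M} {a : ι → M}
    (h : TupleArrows L C b a) (s : β' → β) {t : ι' → ι} (ht : t.Surjective) : TupleArrows L C (b ∘ s) (a ∘ t) := by
  intro χ
  obtain ⟨g, hgC, hg, hmono⟩ := h fun f => χ (f ∘ t)
  have key : ∀ σ : ι' → β', qftp L (b ∘ s ∘ σ) = qftp L (a ∘ t) →
      qftp L (b ∘ (s ∘ σ ∘ Function.surjInv ht)) = qftp L a ∧
        g ∘ s ∘ σ = (g ∘ (s ∘ σ ∘ Function.surjInv ht)) ∘ t := by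
    intro σ hσ
    constructor
    · have := qftp_comp hσ (Function.surjInv ht)
      have e : (a ∘ t) ∘ Function.surjInv ht = a := by
        funext x
        simp [Function.surjInv_eq]
      rwa [e] at this
    · funext x
      have := hσ.symm.trans (qftp_comp hg (s ∘ σ)).symm
      exact eq_of_qftp_eq this (by simp [Function.surjInv_eq])
  refine ⟨g ∘ s, fun _ => hgC _, qftp_comp hg s, fun σ τ hσ hτ => ?_⟩
  obtain ⟨h₁, e₁⟩ := key σ hσ
  obtain ⟨h₂, e₂⟩ := key τ hτ
  have := hmono _ _ h₁ h₂
  rwa [← e₁, ← e₂] at this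

theorem TupleArrows.of_qftp_eq {M' : Type*} [L.Structure M'] {C : Set K} {b : β → M} {a : ι → M}
    {b' : β → M'} {a' : ι → M'} (hb : qftp L b = qftp L b') (ha : qftp L a = qftp L a')
    (h : TupleArrows L C b a) : TupleArrows L C b' a' := by
  intro χ
  obtain ⟨g, hgC, hg, hmono⟩ := h χ
  exact ⟨g, hgC, hg.trans hb, fun σ τ hσ hτ => hmono σ τ
    ((qftp_comp hb σ).trans (hσ.trans ha.symm)) ((qftp_comp hb τ).trans (hτ.trans ha.symm))⟩

theorem tupleArrows_image_iff {K' : Type*} [L.Structure K'] (d : K ↪[L] K') {C : Set K}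
    {b : β → M} {a : ι → M} : TupleArrows L (d '' C) b a ↔ TupleArrows L C b a := by
  constructor
  · intro h χ
    obtain ⟨g, hgC, hg, hmono⟩ := h fun f => ∃ f', d ∘ f' = f ∧ χ f'
    choose g' hg'C hg' using hgC
    obtain rfl : d ∘ g' = g := funext hg'
    refine ⟨g', hg'C, (qftp_embedding d g').symm.trans hg, fun σ τ hσ hτ => ?_⟩
    have key : ∀ f, (∃ f', d ∘ f' = d ∘ f ∧ χ f') ↔ χ f := fun f =>
      ⟨fun ⟨f', h₁, h₂⟩ => d.injective.comp_left h₁ ▸ h₂, fun h => ⟨f, rfl, h⟩⟩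
    exact (key _).symm.trans ((hmono σ τ hσ hτ).trans (key _))
  · intro h χ
    obtain ⟨g, hgC, hg, hmono⟩ := h fun f => χ (d ∘ f)
    exact ⟨d ∘ g, fun x => ⟨_, hgC x, rfl⟩, (qftp_embedding d g).trans hg, hmono⟩

/-- Compactness: an arrow with infinite target reflects to a finite subset of the target. -/
theorem TupleArrows.exists_finset [Finite ι] [Finite β] {b : β → M} {a : ι → M}
    (h : TupleArrows L (Set.univ : Set K) b a) :
    ∃ C : Finset K, TupleArrows L (C : Set K) b a := by
  by_contra! hC
  simp only [TupleArrows, not_forall] at hC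
  choose χ hχ using hC
  -- If each finite `C` has a bad colouring, their limit along an ultrafilter containing all cones
  -- is one colouring of all tuples. A homogeneous copy for it involves finitely many conditions, so
  -- it is homogeneous for the bad colouring of some `C` containing it.
  let U : Ultrafilter (Finset K) := Ultrafilter.of Filter.atTop
  obtain ⟨g, -, hg, hmono⟩ := h fun f => ∀ᶠ C in (U : Filter (Finset K)), χ C f
  have h₁ : ∀ x, ∀ᶠ C in (U : Filter (Finset K)), g x ∈ C := fun x =>
    (Ultrafilter.of_le _) ((Filter.eventually_ge_atTop {g x}).mono fun C hC => by simpa using hC)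
  have h₂ : ∀ p : (ι → β) × (ι → β), qftp L (b ∘ p.1) = qftp L a → qftp L (b ∘ p.2) = qftp L a →
      ∀ᶠ C in (U : Filter (Finset K)), (χ C (g ∘ p.1) ↔ χ C (g ∘ p.2)) := by
    rintro ⟨σ, τ⟩ hσ hτ
    have := hmono σ τ hσ hτ
    by_cases hc : ∀ᶠ C in (U : Filter (Finset K)), χ C (g ∘ σ)
    · filter_upwards [hc, this.1 hc] with C h h' using iff_of_true h h'
    · filter_upwards [Ultrafilter.eventually_not.2 hc,
        Ultrafilter.eventually_not.2 (mt this.2 hc)] with C h h' using iff_of_false h h'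
  simp only [← Filter.eventually_imp_distrib_left] at h₂
  obtain ⟨C, hC₁, hC₂⟩ := ((Filter.eventually_all.2 h₁).and (Filter.eventually_all.2 h₂)).exists
  exact hχ C ⟨g, hC₁, hg, fun σ τ => hC₂ (σ, τ)⟩

end Tuples

/-! ### The Ramsey property of the age, localized in `N` and iterated -/

section AgeRamsey

variable {L : FirstOrder.Language.{u, v}} {N : Type w} [L.Structure N]

/-- The embedding Ramsey property of the age of `N`, phrased inside `N`. -/
theorem hasFERP_iff : HasFERP L N ↔ ∀ (n : ℕ) (a : Fin n → N) (F : Finset N),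
    ∃ C : Finset N, TupleArrows L (C : Set N) (fun x : F => (x : N)) a := by
  classical
  constructor
  · intro h n a F
    let S : L.Substructure N := Substructure.closure L (Set.range a ∪ F)
    have hS : S.FG := Substructure.fg_closure ((Set.finite_range a).union F.finite_toSet)
    have haS : ∀ x, a x ∈ S := fun x => Substructure.subset_closure (Or.inl ⟨x, rfl⟩)
    have hFS : ∀ x : F, (x : N) ∈ S := fun x => Substructure.subset_closure (Or.inr x.2)
    let a' : Fin n → S := fun x => ⟨a x, haS x⟩
    let b' : F → S := fun x => ⟨x, hFS x⟩
    obtain ⟨Q, ⟨-, ⟨d⟩⟩, C, hC⟩ := h (CategoryTheory.Bundled.of S)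
      ⟨(Substructure.fg_iff_structure_fg S).1 hS, ⟨S.subtype⟩⟩
      (Finset.univ.image a') (Finset.univ.image b')
    have h₁ := ((arrows_two_iff _ _ _).1 hC).comp
      (fun x : F => ⟨b' x, Finset.mem_image_of_mem _ (Finset.mem_univ _)⟩)
      (t := fun x : Fin n => ⟨a' x, Finset.mem_image_of_mem _ (Finset.mem_univ _)⟩)
      (by rintro ⟨y, hy⟩; obtain ⟨x, -, rfl⟩ := Finset.mem_image.1 hy; exact ⟨x, rfl⟩)
    refine ⟨C.map d.toEmbedding, ?_⟩
    have h₂ := (tupleArrows_image_iff d).2 (h₁.of_qftp_eq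
      (b' := fun x : F => (x : N)) (a' := a) (qftp_embedding S.subtype b').symm
      (qftp_embedding S.subtype a').symm)
    rw [Finset.coe_map]
    exact h₂
  · rintro h P ⟨-, ⟨e⟩⟩ A B
    obtain ⟨C, hC⟩ := h A.card (fun x => e (A.equivFin.symm x)) (B.map e.toEmbedding)
    let S : L.Substructure N := Substructure.closure L (C : Set N)
    have hS : S.FG := Substructure.fg_closure C.finite_toSet
    have hCS : ∀ x : C, (x : N) ∈ S := fun x => Substructure.subset_closure x.2
    let f : {x // x ∈ C} ↪ S := ⟨fun x => ⟨x, hCS x⟩, fun x y hxy =>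
      Subtype.ext (congrArg (fun z : S => (z : N)) hxy)⟩
    refine ⟨CategoryTheory.Bundled.of S,
      ⟨(Substructure.fg_iff_structure_fg S).1 hS, ⟨S.subtype⟩⟩,
      C.attach.map f, ?_⟩
    refine (arrows_two_iff (K := S) _ A B).2 ((tupleArrows_image_iff S.subtype).1 ?_)
    have h₁ := hC.comp
      (fun x : B => ⟨e x, Finset.mem_map_of_mem _ x.2⟩) (t := A.equivFin)
      A.equivFin.surjective
    have h₂ := h₁.of_qftp_eq (b' := fun x : B => (x : P)) (a' := fun x : A => (x : P))
      (qftp_embedding e _) (by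
        rw [← qftp_embedding e (fun x : A => (x : P))]
        congr 1; funext x; simp)
    convert h₂
    ext y
    constructor
    · rintro ⟨z, hz, rfl⟩
      obtain ⟨x, -, rfl⟩ := Finset.mem_map.1 hz
      exact x.2
    · exact fun hy => ⟨f ⟨y, hy⟩, Finset.mem_map_of_mem _ (C.mem_attach ⟨y, hy⟩), rfl⟩

/-- The map `g` copies `F`, and it makes `F` homogeneous for the colourings in the list `l`, where
each colouring comes with the tuple whose copies are to be coloured. -/
def IsHomogeneousOn (L : FirstOrder.Language.{u, v}) [L.Structure N]
    (l : List (Σ n : ℕ, (Fin n → N) × ((Fin n → N) → Prop))) (F : Finset N) (g : N → N) : Prop :=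
  qftp L (fun x : F => g x) = qftp L (fun x : F => (x : N)) ∧
    ∀ c ∈ l, ∀ σ τ : Fin c.1 → F, qftp L (fun x => (σ x : N)) = qftp L c.2.1 →
      qftp L (fun x => (τ x : N)) = qftp L c.2.1 →
        (c.2.2 (fun x => g (σ x)) ↔ c.2.2 (fun x => g (τ x)))

theorem IsHomogeneousOn.mono {l l' : List (Σ n : ℕ, (Fin n → N) × ((Fin n → N) → Prop))}
    {F F' : Finset N} {g : N → N} (h : IsHomogeneousOn L l F g) (hl : l' ⊆ l) (hF : F' ⊆ F) :
    IsHomogeneousOn L l' F' g :=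
  ⟨qftp_comp h.1 fun x : F' => ⟨x, hF x.2⟩, fun c hc σ τ =>
    h.2 c (hl hc) (fun x => ⟨σ x, hF (σ x).2⟩) (fun x => ⟨τ x, hF (τ x).2⟩)⟩

theorem HasFERP.exists_isHomogeneousOn (h : HasFERP L N)
    (l : List (Σ n : ℕ, (Fin n → N) × ((Fin n → N) → Prop))) (F : Finset N) :
    ∃ g : N → N, IsHomogeneousOn L l F g := by
  classical
  induction l generalizing F with
  | nil => exact ⟨id, rfl, by simp⟩
  | cons c l ih =>
    obtain ⟨n, a, χ⟩ := c
    obtain ⟨C, hC⟩ := hasFERP_iff.1 h n a F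
    -- The order matters: `C` is first copied homogeneously for the remaining colourings, and the
    -- arrow is then applied to the first colouring pulled back along `g₂`. Passing from `C` to the
    -- copy of `F` inside it preserves the earlier homogeneity.
    obtain ⟨g₂, hg₂, hl⟩ := ih C
    obtain ⟨g₁, hgC, hg₁, hmono⟩ := hC fun f => χ (g₂ ∘ f)
    let s : F → C := fun x => ⟨g₁ x, hgC x⟩
    have hg : ∀ x : F, (if hx : (x : N) ∈ F then g₂ (g₁ ⟨x, hx⟩) else x) = g₂ (s x) :=
      fun x => by simp [s]
    have hs : qftp L (fun x => (s x : N)) = qftp L (fun x : F => (x : N)) := hg₁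
    refine ⟨fun x => if hx : x ∈ F then g₂ (g₁ ⟨x, hx⟩) else x, ?_, ?_⟩
    · simp only [hg]
      exact (qftp_comp hg₂ s).trans hg₁
    · simp only [hg, List.mem_cons]
      rintro c (rfl | hc) σ τ hσ hτ
      · exact hmono σ τ hσ hτ
      · exact hl c hc (s ∘ σ) (s ∘ τ) ((qftp_comp hs σ).trans hσ) ((qftp_comp hs τ).trans hτ)

end AgeRamsey

/-! ### Realizing types in few variables in saturated structures -/

section Saturation

variable {L : FirstOrder.Language.{u, v}}

/-- Quantifying out all variables outside `D`. -/
theorem exists_formula_realize_iff_exists {M X : Type*} [L.Structure M] [Nonempty M]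
    (φ : L.Formula X) (D : Set X) : ∃ ψ : L.Formula D, ∀ v : D → M,
      ψ.Realize v ↔ ∃ g : X → M, (∀ d : D, g d = v d) ∧ φ.Realize g := by
  classical
  let f : BoundedFormula.freeVarFinset φ → D ⊕ BoundedFormula.freeVarFinset φ :=
    fun y => if hy : (y : X) ∈ D then Sum.inl ⟨y, hy⟩ else Sum.inr y
  let φ' : L.Formula (D ⊕ BoundedFormula.freeVarFinset φ) := BoundedFormula.restrictFreeVar φ f
  refine ⟨φ'.iExs _, fun v => ?_⟩
  rw [Formula.realize_iExs]
  constructor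
  · rintro ⟨i, hi⟩
    let g : X → M := fun y => if hy : y ∈ D then v ⟨y, hy⟩ else
      if hy' : y ∈ BoundedFormula.freeVarFinset φ then i ⟨y, hy'⟩ else Classical.arbitrary M
    refine ⟨g, fun d => by simp [g], ?_⟩
    refine (BoundedFormula.realize_restrictFreeVar g ?_).1 hi
    intro y
    by_cases hy : (y : X) ∈ D <;> simp [f, g, hy]
  · rintro ⟨g, hgv, hg⟩
    refine ⟨fun y => g y, (BoundedFormula.realize_restrictFreeVar g ?_).2 hg⟩
    intro y
    by_cases hy : (y : X) ∈ D
    · simp [f, hy, ← hgv]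
    · simp [f, hy]

/-- The assignment with graph `G` can be extended to a realization of any finite part of `p`. -/
def IsFinitelyExtendable {M X : Type*} [L.Structure M] (p : Set (L.Formula X))
    (G : Set (X × M)) : Prop :=
  ∀ p₀ : Finset (L.Formula X), (p₀ : Set (L.Formula X)) ⊆ p →
    ∀ G₀ : Finset (X × M), (G₀ : Set (X × M)) ⊆ G →
      ∃ g : X → M, (∀ φ ∈ p₀, φ.Realize g) ∧ ∀ q ∈ G₀, g q.1 = q.2

theorem IsFinitelyExtendable.snd_eq {M X : Type*} [L.Structure M] {p : Set (L.Formula X)}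
    {G : Set (X × M)} (h : IsFinitelyExtendable p G) {x : X} {c d : M} (hc : (x, c) ∈ G)
    (hd : (x, d) ∈ G) : c = d := by
  classical
  obtain ⟨g, -, hg⟩ := h ∅ (by simp) {(x, c), (x, d)} (by simp [Set.insert_subset_iff, hc, hd])
  exact (hg (x, c) (by simp)).symm.trans (hg (x, d) (by simp))

/-- The value at `x` realizes a one-variable type over the values already assigned. These number
fewer than `κ`, since `G` is the graph of a partial function on `X`. -/
theorem IsFinitelyExtendable.exists_insert {κ : Cardinal.{x}} {M X : Type x} [L.Structure M]
    [Nonempty M] (hM : IsSaturated L κ M) (hX : #X < κ) {p : Set (L.Formula X)}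
    {G : Set (X × M)} (h : IsFinitelyExtendable p G) (x : X) (hx : ∀ c, (x, c) ∉ G) :
    ∃ c, IsFinitelyExtendable p (insert (x, c) G) := by
  classical
  let A : Set M := Prod.snd '' G
  have hA : #A < κ := by
    refine lt_of_le_of_lt (Cardinal.mk_image_le.trans ?_) hX
    refine Cardinal.mk_le_of_injective (f := fun q : G => q.1.1) ?_
    rintro ⟨⟨y, c⟩, hc⟩ ⟨⟨z, d⟩, hd⟩ hyz
    obtain rfl : y = z := hyz
    obtain rfl := h.snd_eq hc hd
    rfl
  -- The formulas forced on `g x` by finitely many formulas of `p` and finitely many assigned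
  -- values.
  let q : Set (L.Formula (A ⊕ Unit)) := {θ | ∃ (p₀ : Finset (L.Formula X)) (G₀ : Finset (X × M)),
    (p₀ : Set (L.Formula X)) ⊆ p ∧ (G₀ : Set (X × M)) ⊆ G ∧
    ∀ g : X → M, (∀ φ ∈ p₀, φ.Realize g) → (∀ r ∈ G₀, g r.1 = r.2) →
      θ.Realize (Sum.elim (fun a : A => (a : M)) (fun _ => g x))}
  obtain ⟨c, hc⟩ := hM A hA q (by
    intro q₀ hq₀
    have hq₀' : ∀ θ : q₀, (θ : L.Formula (A ⊕ Unit)) ∈ q := fun θ => hq₀ θ.2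
    choose p₁ G₁ hp₁ hG₁ hθ using hq₀'
    obtain ⟨g, hg, hg'⟩ := h (q₀.attach.biUnion p₁) (by simpa using hp₁)
      (q₀.attach.biUnion G₁) (by simpa using hG₁)
    refine ⟨g x, fun θ hθq => hθ ⟨θ, hθq⟩ g (fun φ hφ => hg φ ?_) fun r hr => hg' r ?_⟩
    · exact Finset.mem_biUnion.2 ⟨⟨θ, hθq⟩, Finset.mem_attach _ _, hφ⟩
    · exact Finset.mem_biUnion.2 ⟨⟨θ, hθq⟩, Finset.mem_attach _ _, hr⟩)
  refine ⟨c, fun p₀ hp₀ G₀ hG₀ => ?_⟩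
  let G₁ : Finset (X × M) := G₀.filter (· ∈ G)
  have hG₁ : (G₁ : Set (X × M)) ⊆ G := fun r hr => (Finset.mem_filter.1 hr).2
  let D : Set X := {y | y = x ∨ ∃ m, (y, m) ∈ G₁}
  have hD : ∀ d : D, (d : X) ≠ x → ∃ m, ((d : X), m) ∈ G₁ := fun d hd => d.2.resolve_left hd
  let ρ : D → A ⊕ Unit := fun d => if hd : (d : X) = x then Sum.inr () else
    Sum.inl ⟨(hD d hd).choose, _, hG₁ (hD d hd).choose_spec, rfl⟩
  obtain ⟨ψ, hψ⟩ := exists_formula_realize_iff_exists (M := M)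
    (Formula.iInf fun φ : p₀ => (φ : L.Formula X)) D
  -- Existence of a realization of `p₀` with the prescribed values is itself a forced formula, so
  -- `c` satisfies it.
  have hmem : ψ.relabel ρ ∈ q := by
    refine ⟨p₀, G₁, hp₀, hG₁, fun g hg hg' => ?_⟩
    rw [Formula.realize_relabel, hψ]
    refine ⟨g, fun d => ?_, by simpa using hg⟩
    by_cases hd : (d : X) = x
    · simp [ρ, hd]
    · simpa [ρ, hd] using hg' _ (hD d hd).choose_spec
  have := hc _ hmem
  rw [Formula.realize_relabel, hψ] at this
  obtain ⟨g, hgD, hg⟩ := this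
  refine ⟨g, by simpa using hg, ?_⟩
  rintro ⟨y, m⟩ hy
  rcases hG₀ hy with hy' | hy'
  · obtain ⟨rfl, rfl⟩ := Prod.mk.inj hy'
    simpa [ρ] using hgD ⟨y, Or.inl rfl⟩
  · have hyx : y ≠ x := by
      rintro rfl
      exact hx _ hy'
    have hyD : y ∈ D := Or.inr ⟨m, Finset.mem_filter.2 ⟨hy, hy'⟩⟩
    have := hgD ⟨y, hyD⟩
    simp only [ρ, Function.comp_apply, hyx, dite_false, Sum.elim_inl] at this
    exact this.trans (h.snd_eq (hG₁ (hD ⟨y, hyD⟩ hyx).choose_spec) hy')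

/-- A `κ`-saturated structure realizes all finitely satisfiable sets of formulas in fewer than `κ`
variables. -/
theorem IsSaturated.exists_realize {κ : Cardinal.{x}} {M X : Type x} [L.Structure M] [Nonempty M]
    (hM : IsSaturated L κ M) (hX : #X < κ) (p : Set (L.Formula X))
    (hp : ∀ p₀ : Finset (L.Formula X), (p₀ : Set (L.Formula X)) ⊆ p →
      ∃ g : X → M, ∀ φ ∈ p₀, φ.Realize g) : ∃ g : X → M, ∀ φ ∈ p, φ.Realize g := by
  obtain ⟨G, -, hG⟩ := zorn_subset_nonempty {G : Set (X × M) | IsFinitelyExtendable p G} (by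
    intro 𝒢 h𝒢 hchain hne
    refine ⟨⋃₀ 𝒢, fun p₀ hp₀ G₀ hG₀ => ?_, fun s hs => Set.subset_sUnion_of_mem hs⟩
    obtain ⟨G, hG, hG₀G⟩ := hchain.directedOn.exists_mem_subset_of_finite_of_subset_sUnion hne
      G₀.finite_toSet hG₀
    exact h𝒢 hG p₀ hp₀ G₀ hG₀G) ∅ (by
    intro p₀ hp₀ G₀ hG₀
    obtain ⟨g, hg⟩ := hp p₀ hp₀
    exact ⟨g, hg, fun q hq => (hG₀ hq).elim⟩)
  have htot : ∀ x, ∃ c, (x, c) ∈ G := by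
    intro x
    by_contra! hx
    obtain ⟨c, hc⟩ := IsFinitelyExtendable.exists_insert hM hX hG.prop x hx
    exact hx c (hG.le_of_ge hc (Set.subset_insert _ _) (Set.mem_insert _ _))
  choose f hf using htot
  refine ⟨f, fun φ hφ => ?_⟩
  classical
  obtain ⟨g, hg, hgf⟩ := hG.prop {φ} (by simpa using hφ)
    ((BoundedFormula.freeVarFinset φ).image fun x => (x, f x)) (by
      intro r hr
      obtain ⟨x, -, rfl⟩ := Finset.mem_image.1 hr
      exact hf x)
  have h₁ : ∀ y : BoundedFormula.freeVarFinset φ, g y = f y :=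
    fun y => hgf _ (Finset.mem_image_of_mem (fun x => (x, f x)) y.2)
  have h₂ := (BoundedFormula.realize_restrictFreeVar (f := id) (v := fun y => f y)
    (xs := default) g fun y => (h₁ y).symm).2 (hg φ (by simp))
  exact (BoundedFormula.realize_restrictFreeVar (f := id) f fun y => rfl).1 h₂

end Saturation

/-! ### The Ramsey property implies the modelling property -/

section RamseyToModelling

theorem tpOn_eq {L : FirstOrder.Language.{u, v}} {M : Type*} [L.Structure M] {ι : Type*}
    {Δ : Set (L.Formula ι)} {a b : ι → M} (h : ∀ φ ∈ Δ, (φ.Realize a ↔ φ.Realize b)) :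
    tpOn Δ a = tpOn Δ b := by
  ext φ
  refine and_congr_left ?_
  rintro (hφ | hφ)
  · exact h φ hφ
  · have := h _ hφ
    simpa [tp, not_iff_not] using this

theorem HasFERP.modelsSequencesIn {L' : FirstOrder.Language.{u, v}} {N : Type w} [L'.Structure N]
    (h : HasFERP L' N) {L : FirstOrder.Language.{u₁, v₁}} {κ : Cardinal.{max u₁ v₁ w}}
    {M α : Type (max u₁ v₁ w)} [L.Structure M] [Nonempty M] (hM : IsSaturated L κ M)
    (hκ : ℵ₀ ≤ κ) (hN : Cardinal.lift.{max u₁ v₁} #N < κ) (hα : #α < κ) :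
    ModelsSequencesIn L' N L M α := by
  classical
  intro a
  have hX : #(N × α) < κ := by
    rw [Cardinal.mk_prod, Cardinal.lift_id'.{w, max u₁ v₁ w}]
    exact Cardinal.mul_lt_of_lt hκ (Cardinal.lift_umax.{w, max u₁ v₁} ▸ hN) (by simpa using hα)
  -- What holds along every re-indexing of `a` that is sufficiently homogeneous; finitely many such
  -- demands merge into one list and one finite set.
  let p : Set (L.Formula (N × α)) := {ψ | ∃ l F, ∀ g : N → N, IsHomogeneousOn L' l F g →
    ψ.Realize fun q => a (g q.1) q.2}
  obtain ⟨b, hb⟩ := hM.exists_realize hX p (by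
    intro p₀ hp₀
    have hp₀' : ∀ ψ : p₀, (ψ : L.Formula (N × α)) ∈ p := fun ψ => hp₀ ψ.2
    choose l F hlF using hp₀'
    obtain ⟨g, hg⟩ := h.exists_isHomogeneousOn (p₀.attach.toList.flatMap l) (p₀.attach.biUnion F)
    refine ⟨fun q => a (g q.1) q.2, fun ψ hψ => hlF ⟨ψ, hψ⟩ g (hg.mono ?_ ?_)⟩
    · exact fun c hc => List.mem_flatMap.2 ⟨⟨ψ, hψ⟩, by simp, hc⟩
    · exact fun c hc => Finset.mem_biUnion.2 ⟨⟨ψ, hψ⟩, by simp, hc⟩)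
  let c : N → α → M := fun s t => b (s, t)
  have hiff : ∀ (n : ℕ) (i j : Fin n → N) (φ : L.Formula (Fin n × α)), qftp L' i = qftp L' j →
      (φ.Realize (concat c i) ↔ φ.Realize (concat c j)) := by
    intro n i j φ hij
    have := hb ((φ.relabel fun q => (i q.1, q.2)).iff (φ.relabel fun q => (j q.1, q.2)))
      -- Homogeneity for the colouring by truth of `φ` along `a` gives this instance of
      -- indiscernibility.
      ⟨[⟨n, i, fun t => φ.Realize (concat a t)⟩], Finset.univ.image i ∪ Finset.univ.image j,
        fun g hg => ?_⟩
    · rwa [Formula.realize_iff, Formula.realize_relabel, Formula.realize_relabel] at this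
    · have := hg.2 _ (List.mem_singleton.2 rfl) (fun x => ⟨i x, by simp⟩) (fun x => ⟨j x, by simp⟩)
        rfl hij.symm
      rwa [Formula.realize_iff, Formula.realize_relabel, Formula.realize_relabel]
  have hEM : ∀ (n : ℕ) (i : Fin n → N) (φ : L.Formula (Fin n × α)),
      (∀ j, qftp L' i = qftp L' j → φ.Realize (concat a j)) → φ.Realize (concat c i) := by
    intro n i φ hφ
    have := hb (φ.relabel fun q => (i q.1, q.2)) ⟨[], Finset.univ.image i, fun g hg => ?_⟩
    · rwa [Formula.realize_relabel] at this
    · have := hφ (g ∘ i) (qftp_comp hg.1 fun x => ⟨i x, by simp⟩).symm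
      rwa [Formula.realize_relabel]
  refine ⟨c, fun n i j hij => Set.ext fun φ => hiff n i j φ hij, fun n Δ i => ?_⟩
  by_contra! hne
  -- If no `j` worked, the negation of the `Δ`-type of `c` at `i` would hold along `a` at all `j` of
  -- the right type, hence would hold of `c` at `i`.
  have := hEM n i (Formula.iInf fun φ : Δ =>
    if φ.1.Realize (concat c i) then φ.1 else φ.1.not).not fun j hj => by
      rw [Formula.realize_not, Formula.realize_iInf]
      intro hall
      refine hne j hj (tpOn_eq fun φ hφ => ?_)
      have := hall ⟨φ, hφ⟩
      by_cases hc : φ.Realize (concat c i) <;> simp_all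
  rw [Formula.realize_not, Formula.realize_iInf] at this
  refine this fun φ => ?_
  by_cases hc : φ.1.Realize (concat c i) <;> simp [hc]

theorem HasFERP.hasMPSmall {L' : FirstOrder.Language.{u, v}} {N : Type w} [L'.Structure N]
    (h : HasFERP L' N) : HasMPSmall.{u, v, u₁, v₁, w} L' N := by
  intro L T _ _ κ M _ _ hM α hα
  obtain ⟨hκ, -, hN, hsat, -⟩ := hM
  rcases isEmpty_or_nonempty M with hM | hM
  · refine fun a => ⟨a, fun n i j _ => congrArg _ ?_, fun n Δ i => ⟨i, rfl, rfl⟩⟩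
    exact funext fun q => isEmptyElim (a (i q.1) q.2)
  · exact h.modelsSequencesIn hsat hκ.le hN hα

/-- The modelling property transfers along an equivalence of the lengths of the tuples. -/
theorem ModelsSequencesIn.of_equiv {L' : FirstOrder.Language.{u, v}} {N : Type w} [L'.Structure N]
    {L : FirstOrder.Language.{u₁, v₁}} {M α β : Type*} [L.Structure M] (e : α ≃ β)
    (h : ModelsSequencesIn L' N L M α) : ModelsSequencesIn L' N L M β := by
  classical
  intro a
  obtain ⟨b, hb, hba⟩ := h fun s => a s ∘ e
  have hc : ∀ {n : ℕ} (d : N → α → M) (i : Fin n → N),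
      concat (fun s => d s ∘ e.symm) i = concat d i ∘ Prod.map id e.symm := fun _ _ => rfl
  refine ⟨fun s => b s ∘ e.symm, fun n i j hij => ?_, fun n Δ i => ?_⟩
  · rw [hc, hc]
    exact tp_comp (hb n i j hij) _
  · obtain ⟨j, hij, hj⟩ := hba n (Δ.image (Formula.relabel (Prod.map id e.symm))) i
    refine ⟨j, hij, tpOn_eq fun φ hφ => ?_⟩
    have := Set.ext_iff.1 hj (φ.relabel (Prod.map id e.symm))
    have hm : φ.relabel (Prod.map id e.symm) ∈
      ((Δ.image (Formula.relabel (Prod.map id e.symm)) : Finset _) : Set _) :=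
      Finset.mem_coe.2 (Finset.mem_image_of_mem _ hφ)
    have ha : concat (fun s => (a s ∘ e) ∘ e.symm) j = concat a j := by
      funext q
      simp [concat]
    simpa only [tpOn, tp, Set.mem_ofPred_eq, hm, true_or, and_true, Formula.realize_relabel, ← hc,
      ha] using this

theorem HasMPSmall.hasMP {L' : FirstOrder.Language.{u, v}} {N : Type w} [L'.Structure N]
    (h : HasMPSmall.{u, v, u₁, v₁, w} L' N) : HasMP.{u, v, u₁, v₁, w} L' N := by
  intro L T hT hinf κ M _ _ hM m
  refine (h L T hT hinf κ M hM (ULift (Fin m)) (lt_trans ?_ hM.1)).of_equiv Equiv.ulift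
  exact Cardinal.lt_aleph0_of_finite _

end RamseyToModelling

/-! ### A saturated structure with a generic relation -/

section GenericRelation

/-- The language with a single relation symbol, of arity `n`. -/
def relLanguage (n : ℕ) : FirstOrder.Language.{u₁, v₁} where
  Functions _ := PEmpty
  Relations k := ULift (PLift (k = n))

/-- The relation symbol of `relLanguage n`. -/
def relSymbol (n : ℕ) : (relLanguage.{u₁, v₁} n).Relations n :=
  ⟨⟨rfl⟩⟩

theorem card_relLanguage_le (n : ℕ) : (relLanguage.{u₁, v₁} n).card ≤ ℵ₀ := by
  have h₁ : IsEmpty (Σ k, (relLanguage.{u₁, v₁} n).Functions k) := ⟨fun f => nomatch f.2⟩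
  have h₂ : Subsingleton (Σ k, (relLanguage.{u₁, v₁} n).Relations k) := by
    constructor
    rintro ⟨k, ⟨⟨rfl⟩⟩⟩ ⟨l, ⟨⟨rfl⟩⟩⟩
    rfl
  have : Countable (relLanguage.{u₁, v₁} n).Symbols :=
    inferInstanceAs (Countable ((Σ k, (relLanguage.{u₁, v₁} n).Functions k) ⊕
      Σ k, (relLanguage.{u₁, v₁} n).Relations k))
  exact Cardinal.mk_le_aleph0

/-- The elements freely generated by `X` by adding, for each family `f` of elements and each set `S`
of patterns, an element `node f S` whose relations to the members of `f` are given by `S`. The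
parameter `χ` is the `n`-ary relation on the generators. -/
inductive GenericModel (n : ℕ) (I X : Type x) (χ : Set (Fin n → X)) : Type x
  | base : X → GenericModel n I X χ
  | node : (I → GenericModel n I X χ) → Set (Fin n → Option I) → GenericModel n I X χ

namespace GenericModel

variable {n : ℕ} {I X : Type x} {χ : Set (Fin n → X)}

/-- The generic `n`-ary relation. -/
def Rel (t : Fin n → GenericModel n I X χ) : Prop :=
  (∃ s ∈ χ, t = fun k => base (s k)) ∨
    ∃ (f : I → GenericModel n I X χ) (S : Set (Fin n → Option I)) (s : Fin n → Option I),
      s ∈ S ∧ (∃ k, s k = none) ∧ t = fun k => (s k).elim (node f S) f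

instance : (relLanguage.{u₁, v₁} n).Structure (GenericModel n I X χ) where
  funMap f := nomatch f
  RelMap r t := Rel (t ∘ Fin.cast r.down.down.symm)

theorem realize_relSymbol {γ : Type*} (s : Fin n → γ) (v : γ → GenericModel n I X χ) :
    ((relSymbol.{u₁, v₁} n).formula fun k => Term.var (s k)).Realize v ↔ Rel (v ∘ s) :=
  Iff.rfl

theorem rel_base_iff (s : Fin n → X) :
    Rel (fun k => (base (s k) : GenericModel n I X χ)) ↔ s ∈ χ := by
  constructor
  · rintro (⟨s', hs', h⟩ | ⟨f, S, s', -, ⟨k, hk⟩, h⟩)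
    · obtain rfl : s = s' := funext fun k => base.inj (congrFun h k)
      exact hs'
    · have := congrFun h k
      simp [hk] at this
  · exact fun h => Or.inl ⟨s, h, rfl⟩

/-- `x` is one of the elements over which `y` has been added. -/
def IsParameter (x y : GenericModel n I X χ) : Prop :=
  ∃ f S i, y = node f S ∧ x = f i

/-- Well-foundedness makes each node differ from its parameters and forbids two nodes from being
parameters of each other, so a related tuple reveals the node that created it. -/
theorem wellFounded_isParameter : WellFounded (IsParameter (χ := χ) (I := I)) := by
  refine ⟨fun y => ?_⟩
  induction y with
  | base a => exact ⟨_, fun x ⟨f, S, i, h, _⟩ => nomatch h⟩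
  | node f S ih =>
    refine ⟨_, ?_⟩
    rintro x ⟨f', S', i, h, rfl⟩
    obtain ⟨rfl, rfl⟩ := node.inj h
    exact ih i

theorem node_ne (f : I → GenericModel n I X χ) (S : Set (Fin n → Option I)) (i : I) :
    f i ≠ node f S := fun h =>
  wellFounded_isParameter.irrefl.irrefl (node f S) ⟨f, S, i, rfl, h.symm⟩

/-- Since `f` need not be injective, different patterns may describe the same tuple; `hS` asks that
`S` not distinguish them. -/
theorem rel_node_iff {f : I → GenericModel n I X χ} {S : Set (Fin n → Option I)}
    (hS : ∀ s ∈ S, ∀ s', (∀ c, (∀ i, f i ≠ c) → ∀ k, (s k).elim c f = (s' k).elim c f) → s' ∈ S)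
    {s : Fin n → Option I} (hs : ∃ k, s k = none) :
    Rel (fun k => (s k).elim (node f S) f) ↔ s ∈ S := by
  constructor
  · rintro (⟨s', -, h⟩ | ⟨f', S', s', hs', ⟨k', hk'⟩, h⟩)
    · obtain ⟨k, hk⟩ := hs
      have := congrFun h k
      simp [hk] at this
    · have key : node f S = node f' S' := by
        obtain ⟨k, hk⟩ := hs
        have h₁ := congrFun h k
        have h₂ := congrFun h k'
        simp only [hk, hk', Option.elim_none] at h₁ h₂
        rcases hi : s' k with _ | i
        · simpa [hi] using h₁
        rcases hj : s k' with _ | j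
        · simpa [hj] using h₂
        rw [hi, Option.elim_some] at h₁
        rw [hj, Option.elim_some] at h₂
        have h₃ : IsParameter (node f S) (node f' S') := ⟨f', S', i, rfl, h₁⟩
        have h₄ : IsParameter (node f' S') (node f S) := ⟨f, S, j, rfl, h₂.symm⟩
        exact (wellFounded_isParameter.asymmetric _ _ h₃ h₄).elim
      obtain ⟨rfl, rfl⟩ := node.inj key
      refine hS s' hs' s fun c hc k => ?_
      have hk := congrFun h k
      rcases hi : s k with _ | i <;> rcases hj : s' k with _ | j <;>
        simp only [hi, hj, Option.elim_none, Option.elim_some] at hk ⊢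
      · exact (node_ne f S j hk.symm).elim
      · exact (node_ne f S i hk).elim
      · exact hk.symm
  · exact fun h => Or.inr ⟨f, S, s, h, hs, rfl⟩

/-- The tuples `v` and `v'` satisfy the same atomic formulas. -/
def SameAtomic {γ : Type*} (v v' : γ → GenericModel n I X χ) : Prop :=
  (∀ i j, v i = v j ↔ v' i = v' j) ∧ ∀ s : Fin n → γ, Rel (v ∘ s) ↔ Rel (v' ∘ s)

theorem SameAtomic.symm {γ : Type*} {v v' : γ → GenericModel n I X χ} (h : SameAtomic v v') :
    SameAtomic v' v :=
  ⟨fun i j => (h.1 i j).symm, fun s => (h.2 s).symm⟩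

theorem SameAtomic.comp {γ δ : Type*} {v v' : γ → GenericModel n I X χ} (h : SameAtomic v v')
    (σ : δ → γ) : SameAtomic (v ∘ σ) (v' ∘ σ) :=
  ⟨fun i j => h.1 (σ i) (σ j), fun s => h.2 (σ ∘ s)⟩

theorem SameAtomic.of_tp_eq {γ : Type*} {v v' : γ → GenericModel n I X χ}
    (h : tp (relLanguage.{u₁, v₁} n) v = tp (relLanguage.{u₁, v₁} n) v') : SameAtomic v v' := by
  refine ⟨fun i j => ?_, fun s => ?_⟩
  · simpa [tp] using Set.ext_iff.1 h ((Term.var i).equal (Term.var j))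
  · have := Set.ext_iff.1 h ((relSymbol.{u₁, v₁} n).formula fun k => Term.var (s k))
    simpa only [tp, Set.mem_ofPred_eq, realize_relSymbol] using this

/-- One-point extension for back-and-forth: either `c` already occurs in `v`, or a new node over
`v'` is given exactly the relations that `c` has over `v`. -/
theorem SameAtomic.exists_extension {γ : Type*} (e : γ ↪ I) {v v' : γ → GenericModel n I X χ}
    (h : SameAtomic v v') (c : GenericModel n I X χ) :
    ∃ c', SameAtomic (fun o : Option γ => o.elim c v) (fun o : Option γ => o.elim c' v') := by
  rcases isEmpty_or_nonempty γ with hγ | hγ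
  · obtain rfl : v = v' := Subsingleton.elim _ _
    exact ⟨c, fun _ _ => Iff.rfl, fun _ => Iff.rfl⟩
  by_cases hc : ∃ i, v i = c
  · obtain ⟨i, rfl⟩ := hc
    refine ⟨v' i, ?_⟩
    convert h.comp (fun o : Option γ => o.elim i id) using 1 <;> funext o <;> cases o <;> rfl
  push Not at hc
  let r : I → γ := Function.invFun e
  have hr : ∀ i, r (e i) = i := Function.leftInverse_invFun e.injective
  let S : Set (Fin n → Option I) := {s | Rel fun k => (s k).elim c (v ∘ r)}
  have hS : ∀ s ∈ S, ∀ s', (∀ c, (∀ i, (v' ∘ r) i ≠ c) →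
      ∀ k, (s k).elim c (v' ∘ r) = (s' k).elim c (v' ∘ r)) → s' ∈ S := by
    intro s hs s' hss
    suffices (fun k => (s' k).elim c (v ∘ r)) = fun k => (s k).elim c (v ∘ r) by
      simpa only [S, Set.mem_ofPred_eq, this] using hs
    funext k
    have hk := hss (node (v' ∘ r) ∅) (node_ne _ _) k
    rcases hi : s k with _ | i <;> rcases hj : s' k with _ | j <;>
      simp only [hi, hj, Option.elim_none, Option.elim_some, Function.comp_apply] at hk ⊢
    · exact (node_ne (v' ∘ r) ∅ j hk.symm).elim
    · exact (node_ne (v' ∘ r) ∅ i hk).elim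
    · exact (h.1 _ _).2 hk.symm
  have hne : ∀ i, v' i ≠ node (v' ∘ r) S := fun i => by
    simpa [hr] using node_ne (v' ∘ r) S (e i)
  refine ⟨node (v' ∘ r) S, ?_, fun s => ?_⟩
  · rintro (_ | i) (_ | j)
    · simp
    · simpa using iff_of_false (hc j).symm (hne j).symm
    · simpa using iff_of_false (hc i) (hne i)
    · exact h.1 i j
  · by_cases hs : ∃ k, s k = none
    · have := rel_node_iff hS (s := fun k => (s k).map e) (by simpa using hs)
      have h₁ : ∀ (d : GenericModel n I X χ) (u : γ → GenericModel n I X χ),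
          (fun k => ((s k).map e).elim d (u ∘ r)) = (fun o : Option γ => o.elim d u) ∘ s := by
        intro d u
        funext k
        rcases hk : s k with _ | i <;> simp [hk, hr]
      simp only [S, Set.mem_ofPred_eq, h₁] at this
      exact this.symm
    · push Not at hs
      choose s' hs' using fun k => Option.ne_none_iff_exists'.1 (hs k)
      obtain rfl : s = fun k => some (s' k) := funext hs'
      exact h.2 s'

theorem nonempty_embedding_of_finite [Infinite I] (γ : Type*) [Finite γ] : Nonempty (γ ↪ I) := by
  obtain ⟨m, ⟨e⟩⟩ := Finite.exists_equiv_fin γ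
  exact ⟨e.toEmbedding.trans (Fin.valEmbedding.trans (Infinite.natEmbedding I))⟩

/-- One-point extension in both directions handles the quantifier step, so atomic information
determines truth of all formulas. -/
theorem SameAtomic.realize_boundedFormula_iff [Infinite I] {γ : Type*} [Finite γ] {k : ℕ}
    (φ : (relLanguage.{u₁, v₁} n).BoundedFormula γ k) {v v' : γ → GenericModel n I X χ}
    {xs xs' : Fin k → GenericModel n I X χ} (h : SameAtomic (Sum.elim v xs) (Sum.elim v' xs')) :
    φ.Realize v xs ↔ φ.Realize v' xs' := by
  induction φ with
  | falsum => rfl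
  | equal t₁ t₂ =>
    rcases t₁ with i | f
    · rcases t₂ with j | f
      · exact h.1 i j
      · exact nomatch f
    · exact nomatch f
  | @rel m l r ts =>
    obtain ⟨⟨rfl⟩⟩ := r
    have : ∀ k, ∃ i, ts k = Term.var i := fun k => by
      rcases hk : ts k with i | f
      · exact ⟨i, rfl⟩
      · exact nomatch f
    choose s hs using this
    obtain rfl : ts = fun k => Term.var (s k) := funext hs
    exact h.2 s
  | imp φ ψ ih₁ ih₂ => exact imp_congr (ih₁ h) (ih₂ h)
  | @all m φ ih =>
    let σ : γ ⊕ Fin (m + 1) → Option (γ ⊕ Fin m) :=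
      Sum.elim (fun i => some (Sum.inl i)) (Fin.snoc (fun i => some (Sum.inr i)) none)
    have hσ : ∀ (u : γ → GenericModel n I X χ) (ys : Fin m → GenericModel n I X χ) (d),
        (fun o : Option (γ ⊕ Fin m) => o.elim d (Sum.elim u ys)) ∘ σ =
          Sum.elim u (Fin.snoc ys d) := by
      intro u ys d
      funext i
      rcases i with i | i
      · rfl
      · refine Fin.lastCases ?_ (fun i => ?_) i <;> simp [σ]
    have key : ∀ {u u' : γ → GenericModel n I X χ} {ys ys' : Fin m → GenericModel n I X χ},
        SameAtomic (Sum.elim u ys) (Sum.elim u' ys') → ∀ d, ∃ d',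
          SameAtomic (Sum.elim u (Fin.snoc ys d)) (Sum.elim u' (Fin.snoc ys' d')) := by
      intro u u' ys ys' hu d
      obtain ⟨e⟩ := nonempty_embedding_of_finite (I := I) (γ ⊕ Fin m)
      obtain ⟨d', hd'⟩ := hu.exists_extension e d
      refine ⟨d', ?_⟩
      rw [← hσ, ← hσ]
      exact hd'.comp σ
    constructor
    · intro hφ c'
      obtain ⟨c, hc⟩ := key h.symm c'
      exact (ih hc.symm).1 (hφ c)
    · intro hφ c
      obtain ⟨c', hc'⟩ := key h c
      exact (ih hc').2 (hφ c')

theorem realize_iff_of_sameAtomic [Infinite I] {γ : Type*} [DecidableEq γ]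
    (φ : (relLanguage.{u₁, v₁} n).Formula γ)
    {v v' : γ → GenericModel n I X χ}
    (h : SameAtomic (fun i : BoundedFormula.freeVarFinset φ => v i) fun i => v' i) :
    φ.Realize v ↔ φ.Realize v' := by
  have key : ∀ u : γ → GenericModel n I X χ,
      (BoundedFormula.restrictFreeVar φ id).Realize (fun i => u i) default ↔ φ.Realize u :=
    fun u => BoundedFormula.realize_restrictFreeVar u fun _ => rfl
  rw [← key, ← key]
  refine SameAtomic.realize_boundedFormula_iff _ ?_
  let σ : BoundedFormula.freeVarFinset φ ⊕ Fin 0 → BoundedFormula.freeVarFinset φ :=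
    Sum.elim id fun i => i.elim0
  convert h.comp σ using 1 <;> funext i <;> rcases i with i | i <;> first | rfl | exact i.elim0

theorem tp_eq_of_sameAtomic [Infinite I] {γ : Type*} {v v' : γ → GenericModel n I X χ}
    (h : SameAtomic v v') : tp (relLanguage.{u₁, v₁} n) v = tp (relLanguage.{u₁, v₁} n) v' := by
  classical
  exact Set.ext fun φ => realize_iff_of_sameAtomic φ (h.comp _)

theorem isHomogeneous [Infinite I] {κ : Cardinal.{x}} (hκ : κ ≤ #I) :
    IsHomogeneous (relLanguage.{u₁, v₁} n) κ (GenericModel n I X χ) := by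
  intro A hA f hf c
  obtain ⟨e⟩ : Nonempty (A ↪ I) := (Cardinal.le_def _ _).1 (hA.le.trans hκ)
  obtain ⟨d, hd⟩ := (SameAtomic.of_tp_eq hf.symm).exists_extension e c
  refine ⟨d, tp_eq_of_sameAtomic ?_⟩
  convert hd.symm.comp (Sum.elim some fun _ : Unit => none) using 1 <;> funext i <;>
    rcases i with i | i <;> rfl

/-- An ultrafilter containing the solution sets of `p` either concentrates at a point, which
realizes `p`, or has a limit atomic type over `A` that avoids `A`; a node realizes the latter. Each
formula depends on finitely many atomic facts, on which the node agrees with almost every `c`. -/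
theorem isSaturated [Infinite I] [Nonempty X] {κ : Cardinal.{x}} (hκ : κ ≤ #I) :
    IsSaturated (relLanguage.{u₁, v₁} n) κ (GenericModel n I X χ) := by
  classical
  intro A hA p hp
  obtain ⟨e⟩ : Nonempty (A ↪ I) := (Cardinal.le_def _ _).1 (hA.le.trans hκ)
  let as : GenericModel n I X χ → A ⊕ Unit → GenericModel n I X χ :=
    fun c => Sum.elim (fun a : A => (a : GenericModel n I X χ)) fun _ => c
  obtain ⟨U, hU⟩ := Ultrafilter.exists_ultrafilter_of_finite_inter_nonempty
    ((fun φ : (relLanguage.{u₁, v₁} n).Formula (A ⊕ Unit) => {c | φ.Realize (as c)}) '' p) (by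
      intro T hT
      obtain ⟨p₀, hp₀, rfl⟩ := Finset.subset_set_image_iff.1 hT
      obtain ⟨c, hc⟩ := hp p₀ hp₀
      exact ⟨c, by simpa using hc⟩)
  have hUp : ∀ φ ∈ p, ∀ᶠ c in (U : Filter (GenericModel n I X χ)), φ.Realize (as c) := fun φ hφ => hU ⟨φ, hφ, rfl⟩
  by_cases hm : ∃ m, ∀ᶠ c in (U : Filter (GenericModel n I X χ)), c = m
  · obtain ⟨m, hm⟩ := hm
    refine ⟨m, fun φ hφ => ?_⟩
    obtain ⟨c, hc, rfl⟩ := ((hUp φ hφ).and hm).exists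
    exact hc
  push Not at hm
  let f : I → GenericModel n I X χ :=
    Function.extend e (fun a : A => (a : GenericModel n I X χ))
      fun _ => base (Classical.arbitrary X)
  have hf : ∀ a : A, f (e a) = a := fun a => e.injective.extend_apply _ _ a
  let S : Set (Fin n → Option I) := {s | ∀ᶠ c in (U : Filter (GenericModel n I X χ)), Rel fun k => (s k).elim c f}
  have hS : ∀ s ∈ S, ∀ s', (∀ c, (∀ i, f i ≠ c) →
      ∀ k, (s k).elim c f = (s' k).elim c f) → s' ∈ S := by
    intro s hs s' hss
    have hk := hss (node f ∅) (node_ne _ _)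
    have : ∀ c, (fun k => (s' k).elim c f) = fun k => (s k).elim c f := by
      intro c
      funext k
      have hk := hk k
      rcases hi : s k with _ | i <;> rcases hj : s' k with _ | j <;>
        simp only [hi, hj, Option.elim_none, Option.elim_some] at hk ⊢
      · exact (node_ne f ∅ j hk.symm).elim
      · exact (node_ne f ∅ i hk).elim
      · exact hk.symm
    simpa only [S, Set.mem_ofPred_eq, this] using hs
  have hne : ∀ a : A, (a : GenericModel n I X χ) ≠ node f S := fun a => by
    simpa [hf] using node_ne f S (e a)
  have hEq : ∀ i j, ∀ᶠ c in (U : Filter (GenericModel n I X χ)),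
      (as c i = as c j ↔ as (node f S) i = as (node f S) j) := by
    rintro (a | _) (b | _)
    · exact Filter.Eventually.of_forall fun c => Iff.rfl
    · filter_upwards [hm a] with c hc using iff_of_false hc.symm (hne a)
    · filter_upwards [hm b] with c hc using iff_of_false hc (hne b).symm
    · exact Filter.Eventually.of_forall fun c => iff_of_true rfl rfl
  have hRel : ∀ s : Fin n → A ⊕ Unit, ∀ᶠ c in (U : Filter (GenericModel n I X χ)),
      (Rel (as c ∘ s) ↔ Rel (as (node f S) ∘ s)) := by
    intro s
    by_cases hs : ∃ k, s k = Sum.inr ()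
    · let s' : Fin n → Option I := fun k => (s k).elim (fun a => some (e a)) fun _ => none
      have h₁ : ∀ c, (fun k => (s' k).elim c f) = as c ∘ s := by
        intro c
        funext k
        rcases hk : s k with a | _ <;> simp [s', as, hk, hf]
      have h₂ := rel_node_iff hS (s := s') (hs.imp fun k hk => by simp [s', hk])
      simp only [S, Set.mem_ofPred_eq, h₁] at h₂
      by_cases h₃ : Rel (as (node f S) ∘ s)
      · filter_upwards [h₂.1 h₃] with c hc using iff_of_true hc h₃
      · filter_upwards [Ultrafilter.eventually_not.2 (mt h₂.2 h₃)] with c hc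
          using iff_of_false hc h₃
    · refine Filter.Eventually.of_forall fun c => iff_of_eq (congrArg _ ?_)
      funext k
      rcases hk : s k with a | _
      · simp [as, hk]
      · exact (hs ⟨k, hk⟩).elim
  refine ⟨node f S, fun φ hφ => ?_⟩
  let V := BoundedFormula.freeVarFinset φ
  have h₁ : ∀ᶠ c in (U : Filter (GenericModel n I X χ)), ∀ i j : V,
      (as c i = as c j ↔ as (node f S) i = as (node f S) j) :=
    Filter.eventually_all.2 fun i => Filter.eventually_all.2 fun j => hEq i j
  have h₂ : ∀ᶠ c in (U : Filter (GenericModel n I X χ)), ∀ s : Fin n → V,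
      (Rel (as c ∘ fun k => (s k : A ⊕ Unit)) ↔
        Rel (as (node f S) ∘ fun k => (s k : A ⊕ Unit))) :=
    Filter.eventually_all.2 fun s => hRel _
  obtain ⟨c, hc₁, hc₂, hc⟩ := (h₁.and (h₂.and (hUp φ hφ))).exists
  refine (realize_iff_of_sameAtomic (v' := as (node f S)) φ ?_).1 hc
  exact ⟨hc₁, hc₂⟩

instance [Infinite I] [Nonempty X] : Infinite (GenericModel n I X χ) := by
  refine not_finite_iff_infinite.1 fun _ => ?_
  obtain ⟨e⟩ := nonempty_embedding_of_finite (I := I) (GenericModel n I X χ)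
  have : Nonempty (GenericModel n I X χ) := ⟨base (Classical.arbitrary X)⟩
  exact node_ne _ _ _ (Function.leftInverse_invFun e.injective (node (Function.invFun e) ∅))

end GenericModel

end GenericRelation

/-! ### The modelling property implies the Ramsey property -/

section ModellingToRamsey

theorem HasMP.hasFERP {L' : FirstOrder.Language.{u, v}} {N : Type w} [L'.Structure N]
    (h : HasMP.{u, v, u₁, v₁, w} L' N) : HasFERP L' N := by
  classical
  refine hasFERP_iff.2 fun n a F => TupleArrows.exists_finset fun χ => ?_
  let κ : Cardinal.{max u₁ v₁ w} := Order.succ (max ℵ₀ (Cardinal.lift.{max u₁ v₁} #N))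
  let I : Type (max u₁ v₁ w) := κ.out
  have hI : #I = κ := Cardinal.mk_out κ
  have hκ : ℵ₀ < κ := lt_of_le_of_lt (le_max_left _ _) (Order.lt_succ _)
  have : Infinite I := Cardinal.infinite_iff.2 (hI ▸ hκ.le)
  -- `Option N` keeps the set of generators nonempty even when `N` is empty.
  let M : Type (max u₁ v₁ w) := GenericModel n I (ULift.{max u₁ v₁} (Option N))
    {t | ∃ s, χ s ∧ t = fun k => ⟨some (s k)⟩}
  let L := relLanguage.{u₁, v₁} n
  have hmon : IsMonster N L κ M := by
    refine ⟨hκ, lt_of_le_of_lt ?_ hκ, lt_of_le_of_lt (le_max_right _ _) (Order.lt_succ _),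
      GenericModel.isSaturated hI.ge, GenericModel.isHomogeneous hI.ge⟩
    simpa using card_relLanguage_le n
  have hinf : Infinite M := inferInstanceAs (Infinite (GenericModel _ _ _ _))
  let c : N → Fin 1 → M := fun s _ => GenericModel.base ⟨some s⟩
  have hc : ∀ t : Fin n → N, GenericModel.Rel (fun k => c (t k) 0) ↔ χ t := by
    intro t
    refine (GenericModel.rel_base_iff fun k => ULift.up (some (t k))).trans ?_
    constructor
    · rintro ⟨s, hs, hst⟩
      obtain rfl : t = s := funext fun k => by simpa using congrFun hst k
      exact hs
    · exact fun ht => ⟨t, ht, rfl⟩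
  have hT : HasInfiniteModel (L.completeTheory M) := by
    -- `M` may live in too large a universe, so Löwenheim–Skolem supplies a countably infinite model
    -- in the required one.
    obtain ⟨K, hMK, hK⟩ := exists_elementarilyEquivalent_card_eq.{u₁, v₁, max u₁ v₁} L M ℵ₀ le_rfl
      (by simpa using card_relLanguage_le n)
    have : Infinite K := Cardinal.infinite_iff.2 hK.ge
    have : K ⊨ L.completeTheory M := by
      rw [hMK.completeTheory_eq]
      infer_instance
    exact ⟨⟨K⟩, ‹Infinite K›⟩
  obtain ⟨b, hb, hbc⟩ := h L (L.completeTheory M) (completeTheory.isComplete L M) hT κ M hmon 1 c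
  let i : Fin F.card → N := fun x => F.equivFin.symm x
  let ρ : (Fin n → Fin F.card) → L.Formula (Fin F.card × Fin 1) := fun τ =>
    (relSymbol.{u₁, v₁} n).formula fun l => Term.var (τ l, 0)
  -- `Δ` consists of the relation applied to all `n`-tuples of positions in `F`; thus `j` is a copy
  -- of `F` whose colours match the relations among the `b`'s.
  obtain ⟨j, hij, hj⟩ := hbc F.card (Finset.univ.image ρ) i
  have hbj : ∀ σ : Fin n → F, GenericModel.Rel (fun k => b (σ k) 0) ↔
      χ fun k => j (F.equivFin (σ k)) := by
    intro σ
    have h₁ := Set.ext_iff.1 hj (ρ fun k => F.equivFin (σ k))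
    have hm : ρ (fun k => F.equivFin (σ k)) ∈ ((Finset.univ.image ρ : Finset _) : Set _) :=
      Finset.mem_coe.2 (Finset.mem_image_of_mem _ (Finset.mem_univ _))
    simp only [tpOn, tp, Set.mem_ofPred_eq, hm, true_or, and_true] at h₁
    rw [GenericModel.realize_relSymbol, GenericModel.realize_relSymbol] at h₁
    refine Iff.trans ?_ (h₁.trans (hc _))
    refine iff_of_eq (congrArg _ (funext fun k => ?_))
    simp [concat, i]
  refine ⟨fun x => j (F.equivFin x), fun _ => Set.mem_univ _, ?_, fun σ τ hσ hτ => ?_⟩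
  · have := qftp_comp hij F.equivFin
    refine this.symm.trans (congrArg _ (funext fun x => ?_))
    simp [i]
  · have h₁ := Set.ext_iff.1 (hb n (fun k => σ k) (fun k => τ k) (hσ.trans hτ.symm))
      ((relSymbol.{u₁, v₁} n).formula fun l => Term.var (l, 0))
    simp only [tp, Set.mem_ofPred_eq] at h₁
    rw [GenericModel.realize_relSymbol, GenericModel.realize_relSymbol] at h₁
    exact (hbj σ).symm.trans (h₁.trans (hbj τ))

end ModellingToRamsey

end GenInd

theorem mainTheorem4 (L' : FirstOrder.Language.{u, v}) (N : Type w)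
    [L'.Structure N] :
    List.TFAE [GenInd.HasFERP L' N, GenInd.HasMP.{u, v, u₁, v₁, w} L' N,
      GenInd.HasMPSmall.{u, v, u₁, v₁, w} L' N] := by
  tfae_have 1 → 3 := GenInd.HasFERP.hasMPSmall
  tfae_have 3 → 2 := GenInd.HasMPSmall.hasMP
  tfae_have 2 → 1 := GenInd.HasMP.hasFERP
  tfae_finish
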